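/- Let $L,R,\alpha,\beta>0$ and $0<d<\pi/2$, and let $\mathscr{D}_d=\{\zeta\in\mathbb{C}:|\operatorname{Im}\zeta|<d\}$. Let $F$ be analytic in $\mathscr{D}_d$ with $$|F(\zeta)|\le \frac{L}{|1+e^{-\pi\sinh\zeta}|^{\alpha}\,|1+e^{\pi\sinh\zeta}|^{\beta}}\quad(\zeta\in\mathscr{D}_d),\qquad |F(x)|\le \frac{R}{(1+e^{-\pi\sinh x})^{\alpha}(1+e^{\pi\sinh x})^{\beta}}\quad(x\in\mathbb{R}).$$ Put $\mu=\min\{\alpha,\beta\}$. Let $q$ be a real-valued function, differentiable on $[0,\infty)$ (one-sidedly at $0$), with $q(x)\ge 0$ and $q'(x)\ge 0$ for all $x\ge 0$, and with $q(d/\mu)>0$. For a positive integer $n$ define $$h=\frac{d}{\mu\,q(dn/\mu)},\qquad M=\left\lceil\frac1h\operatorname{arsinh}\left(\frac{\mu}{\alpha}\,q\left(\frac{dn}{\mu}\right)\right)\right\rceil,\qquad N=\left\lceil\frac1h\operatorname{arsinh}\left(\frac{\mu}{\beta}\,q\left(\frac{dn}{\mu}\right)\right)\right\rceil .$$ Then,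 with $\operatorname{sinc}x=\sin(\pi x)/(\pi x)$ and $\operatorname{sinc}0=1$, $$\sup_{x\in\mathbb{R}}\left|F(x)-\sum_{k=-M}^{N}F(kh)\operatorname{sinc}\left(\frac{x-kh}{h}\right)\right|\le C\,e^{-\pi\mu q(dn/\mu)},$$ where $C$ is the constant, independent of $n$, $$C=\frac{2}{\pi d}\left[\frac{2L}{\pi\mu\,(1-e^{-2\pi\mu q(d/\mu)})\cos^{\alpha+\beta}\left(\frac{\pi}{2}\sin d\right)\cos d}+R\right].$$ -/

import Mathlib

noncomputable section

namespace DESinc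

/-- The strip `{ζ : |Im ζ| < d}` of the complex plane. -/
def strip (d : ℝ) : Set ℂ := {ζ : ℂ | |ζ.im| < d}

/-- The class of functions `F` that are analytic in the strip of half-width `d` and decay double
exponentially there, with constant `L` on the whole strip and constant `R` on the real line. -/
structure InClass (L R α β d : ℝ) (F : ℂ → ℂ) : Prop where
  analytic : AnalyticOnNhd ℂ F (strip d)
  bound_strip : ∀ ζ ∈ strip d,
    ‖F ζ‖ ≤ L / (‖1 + Complex.exp (-(Real.pi * Complex.sinh ζ))‖ ^ α
      * ‖1 + Complex.exp (Real.pi * Complex.sinh ζ)‖ ^ β)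
  bound_real : ∀ x : ℝ,
    ‖F (x : ℂ)‖ ≤ R / ((1 + Real.exp (-(Real.pi * Real.sinh x))) ^ α
      * (1 + Real.exp (Real.pi * Real.sinh x)) ^ β)

/-- The normalized cardinal sine `sin (π x) / (π x)`, with value `1` at `0`. -/
def sinc (x : ℝ) : ℝ := Real.sinc (Real.pi * x)

/-- The truncated Sinc sum `∑_{k=-M}^{N} F(k h) sinc((x - k h) / h)`. -/
def sincSum (F : ℂ → ℂ) (h : ℝ) (M N : ℤ) (x : ℝ) : ℂ :=
  ∑ k ∈ Finset.Icc (-M) N, F (((k : ℝ) * h : ℝ) : ℂ) * (sinc ((x - (k : ℝ) * h) / h) : ℂ)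

/-- The mesh size `h = d / (μ q(d n / μ))`. -/
def meshSize (q : ℝ → ℝ) (d μ : ℝ) (n : ℕ) : ℝ := d / (μ * q (d * n / μ))

/-- The truncation number `⌈(1 / h) arsinh((μ / γ) q(d n / μ))⌉`; `γ = α` gives `M`
and `γ = β` gives `N`. -/
def truncNumber (q : ℝ → ℝ) (d μ γ h : ℝ) (n : ℕ) : ℤ :=
  ⌈1 / h * Real.arsinh (μ / γ * q (d * n / μ))⌉

/-- The constant of the error bound. It does not depend on `n`. -/
def errorConst (q : ℝ → ℝ) (L R α β d : ℝ) : ℝ :=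
  2 / (Real.pi * d) *
    (2 * L / (Real.pi * min α β
        * (1 - Real.exp (-(2 * Real.pi * min α β * q (d / min α β))))
        * Real.cos (Real.pi / 2 * Real.sin d) ^ (α + β) * Real.cos d)
      + R)

end DESinc

end

/-! Write Q = q(dn/μ). The error splits into the discretization error of a long symmetric Sinc sum
and the truncation error from shortening it to -M..N; h, M and N are chosen so that both are of
order exp(-πμQ).

Discretization (`rectIntegral_sinc`, `norm_sub_sincSum_le`): by residues, F(x) minus the symmetric
sum is sin(πx/h)/(2πi) times the integral of F(z)/((z-x) sin(πz/h)) around a rectangle of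
half-height y < d. On the horizontal sides |z-x| ≥ y and |sin(πz/h)| ≥ sinh(πy/h); the vertical
sides disappear as the rectangle lengthens. Letting y tend to d leaves a multiple of 1/sinh(πd/h),
and πd/h = πμQ. The integral of |F| comes from `InClass.norm_le`, which rests on the sharp bound
`le_norm_one_add_exp_pi_mul_sinh`.

Truncation (`InClass.norm_sincSum_sub_le`): |sinc| ≤ 1, and the omitted values of F on the real line
are summed by telescoping, each tail giving at most R/(πd) exp(-πμQ).

Monotonicity of q enters only through q(d/μ) ≤ Q, which frees the constant from n. -/

namespace DESinc

/-! ### Real inequalities behind the strip bound -/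

/-- Jordan's inequality sin θ ≥ 2θ/π together with cos θ ≤ π/2 - θ reduces this to a polynomial
inequality. -/
theorem mul_cos_le_sin_mul {θ : ℝ} (h0 : 0 ≤ θ) (h1 : θ ≤ Real.pi / 2) :
    θ * Real.cos θ ≤ Real.sin θ * (Real.pi ^ 2 / 4 - θ ^ 2) := by
  have hpi := Real.pi_pos
  have hs : 2 / Real.pi * θ ≤ Real.sin θ := Real.mul_le_sin h0 h1
  have hc : Real.cos θ ≤ Real.pi / 2 - θ := by
    rw [← Real.sin_pi_div_two_sub]
    exact Real.sin_le (by linarith)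
  calc θ * Real.cos θ ≤ θ * (Real.pi / 2 - θ) := by gcongr
    _ ≤ 2 / Real.pi * θ * (Real.pi ^ 2 / 4 - θ ^ 2) := by
        have : 2 / Real.pi * θ * (Real.pi ^ 2 / 4 - θ ^ 2) - θ * (Real.pi / 2 - θ)
            = 2 / Real.pi * (θ ^ 2 * (Real.pi / 2 - θ)) := by
          field_simp
          ring
        have h2 : 0 ≤ 2 / Real.pi * (θ ^ 2 * (Real.pi / 2 - θ)) := by
          have : 0 ≤ Real.pi / 2 - θ := by linarith
          positivity
        linarith
    _ ≤ _ := by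
        apply mul_le_mul_of_nonneg_right hs
        nlinarith

/-- Expand sin(θ + (c-1)θ) with cos ≤ 1 and sin u ≤ u, then use c - 1 ≤ (c²-1)/2. The factor is
shaped so that c = cosh x and θ = (π/2)|sin y| turn it into 1 + v²/2 ≤ cosh v. -/
theorem sin_mul_le {θ c : ℝ} (h0 : 0 ≤ θ) (h1 : θ ≤ Real.pi / 2) (hc : 1 ≤ c) :
    Real.sin (c * θ) ≤ (1 + (c ^ 2 - 1) * (Real.pi ^ 2 / 4 - θ ^ 2) / 2) * Real.sin θ := by
  have hpi := Real.pi_pos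
  have hsin : 0 ≤ Real.sin θ := Real.sin_nonneg_of_nonneg_of_le_pi h0 (by linarith)
  have hcos : 0 ≤ Real.cos θ := Real.cos_nonneg_of_neg_pi_div_two_le_of_le (by linarith) h1
  have hu : 0 ≤ (c - 1) * θ := mul_nonneg (by linarith) h0
  have e : c * θ = θ + (c - 1) * θ := by ring
  rw [e, Real.sin_add]
  have i1 : Real.sin θ * Real.cos ((c - 1) * θ) ≤ Real.sin θ * 1 :=
    mul_le_mul_of_nonneg_left (Real.cos_le_one _) hsin
  have i2 : Real.cos θ * Real.sin ((c - 1) * θ) ≤ Real.cos θ * ((c - 1) * θ) :=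
    mul_le_mul_of_nonneg_left (Real.sin_le hu) hcos
  have i3 := mul_cos_le_sin_mul h0 h1
  have i4 : (c - 1) * (θ * Real.cos θ) ≤ (c ^ 2 - 1) / 2 * (θ * Real.cos θ) :=
    mul_le_mul_of_nonneg_right (by nlinarith) (by positivity)
  have i5 : (c ^ 2 - 1) / 2 * (θ * Real.cos θ) ≤
      (c ^ 2 - 1) / 2 * (Real.sin θ * (Real.pi ^ 2 / 4 - θ ^ 2)) :=
    mul_le_mul_of_nonneg_left i3 (by nlinarith)
  nlinarith

theorem abs_sin_mul_le {θ c : ℝ} (h0 : 0 ≤ θ) (h1 : θ ≤ Real.pi / 2) (hc : 1 ≤ c) :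
    |Real.sin (c * θ)| ≤ (1 + (c ^ 2 - 1) * (Real.pi ^ 2 / 4 - θ ^ 2) / 2) * Real.sin θ := by
  have hpi := Real.pi_pos
  have hsin : 0 ≤ Real.sin θ := Real.sin_nonneg_of_nonneg_of_le_pi h0 (by linarith)
  rcases le_total (c * θ) (Real.pi / 2) with h | h
  · rw [abs_of_nonneg (Real.sin_nonneg_of_nonneg_of_le_pi (by positivity) (by linarith))]
    exact sin_mul_le h0 h1 hc
  · have hθ : 0 < θ := by
      rcases h0.lt_or_eq with h' | h'
      · exact h'
      · rw [← h', mul_zero] at h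
        linarith
    -- At this b the sine already equals 1, and the bound only increases from b to c.
    set b := Real.pi / 2 / θ with hb
    have hb1 : 1 ≤ b := by rw [hb, le_div_iff₀ hθ]; linarith
    have hbc : b ≤ c := by rw [hb, div_le_iff₀ hθ]; exact h
    have key := sin_mul_le h0 h1 hb1
    have hbθ : b * θ = Real.pi / 2 := by rw [hb]; field_simp
    rw [hbθ, Real.sin_pi_div_two] at key
    refine (Real.abs_sin_le_one _).trans (key.trans ?_)
    have h3 : 0 ≤ Real.pi ^ 2 / 4 - θ ^ 2 := by nlinarith
    gcongr

theorem one_add_sq_div_two_le_cosh (v : ℝ) : 1 + v ^ 2 / 2 ≤ Real.cosh v := by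
  have h1 : Real.cosh v = 1 + 2 * Real.sinh (v / 2) ^ 2 := by
    have := Real.cosh_two_mul (v / 2)
    rw [Real.cosh_sq, mul_div_cancel₀ v (by norm_num : (2 : ℝ) ≠ 0)] at this
    linarith
  have h2 : (v / 2) ^ 2 ≤ Real.sinh (v / 2) ^ 2 := by
    rw [sq_le_sq]
    rcases le_total 0 (v / 2) with h | h
    · exact abs_le_abs_of_nonneg h (Real.self_le_sinh_iff.2 h)
    · exact abs_le_abs_of_nonpos h (Real.sinh_le_self_iff.2 h)
  nlinarith

theorem sq_sin_pi_div_two_mul_cosh_mul_sin_le (x y : ℝ) :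
    Real.sin (Real.pi * Real.cosh x * Real.sin y / 2) ^ 2 ≤
      Real.cosh (Real.pi * Real.sinh x * Real.cos y / 2) ^ 2 *
        Real.sin (Real.pi / 2 * Real.sin y) ^ 2 := by
  have hpi := Real.pi_pos
  have key := abs_sin_mul_le (θ := Real.pi / 2 * |Real.sin y|) (c := Real.cosh x)
    (by positivity) (by have := Real.abs_sin_le_one y; nlinarith) (Real.one_le_cosh x)
  have hv := one_add_sq_div_two_le_cosh (Real.pi * Real.sinh x * Real.cos y / 2)
  have hsq : (Real.cosh x ^ 2 - 1) * (Real.pi ^ 2 / 4 - (Real.pi / 2 * |Real.sin y|) ^ 2)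
      = (Real.pi * Real.sinh x * Real.cos y / 2) ^ 2 := by
    rw [mul_pow _ |Real.sin y|, sq_abs, Real.cosh_sq, Real.sin_sq]
    ring
  rw [hsq] at key
  have hs0 : 0 ≤ Real.sin (Real.pi / 2 * |Real.sin y|) :=
    Real.sin_nonneg_of_nonneg_of_le_pi (by positivity)
      (by have := Real.abs_sin_le_one y; nlinarith)
  have key2 := key.trans (mul_le_mul_of_nonneg_right hv hs0)
  have key3 := pow_le_pow_left₀ (abs_nonneg _) key2 2
  rw [sq_abs, mul_pow] at key3
  rcases abs_choice (Real.sin y) with h | h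
  · rw [h] at key3
    rwa [show Real.cosh x * (Real.pi / 2 * Real.sin y) =
      Real.pi * Real.cosh x * Real.sin y / 2 by ring] at key3
  · rw [h] at key3
    rw [show Real.cosh x * (Real.pi / 2 * -Real.sin y) =
      -(Real.pi * Real.cosh x * Real.sin y / 2) by ring, Real.sin_neg, neg_sq, mul_neg,
      Real.sin_neg, neg_sq] at key3
    exact key3

/-! ### Lower bound for |1 + exp(π sinh ζ)| -/

theorem four_mul_exp_mul_cosh_sq (a : ℝ) :
    4 * Real.exp a * Real.cosh (a / 2) ^ 2 = (1 + Real.exp a) ^ 2 := by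
  have h : Real.exp a = Real.exp (a / 2) ^ 2 := by
    rw [← Real.exp_nat_mul]
    congr 1
    push_cast
    ring
  rw [Real.cosh_eq, h, Real.exp_neg]
  field_simp
  ring

theorem normSq_one_add_exp (a b : ℝ) :
    Complex.normSq (1 + Complex.exp (a + b * Complex.I)) =
      4 * Real.exp a * (Real.cosh (a / 2) ^ 2 - Real.sin (b / 2) ^ 2) := by
  have h1 := four_mul_exp_mul_cosh_sq a
  have h2 : Real.cos b = 1 - 2 * Real.sin (b / 2) ^ 2 := by
    have := Real.cos_two_mul (b / 2)
    rw [mul_div_cancel₀ b (by norm_num : (2 : ℝ) ≠ 0), Real.cos_sq'] at this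
    linarith
  have h3 : Complex.normSq (1 + Complex.exp (a + b * Complex.I)) =
      1 + 2 * Real.exp a * Real.cos b + Real.exp a ^ 2 := by
    rw [Complex.normSq_apply]
    simp only [Complex.add_re, Complex.one_re, Complex.add_im, Complex.one_im, Complex.exp_re,
      Complex.exp_im, Complex.ofReal_re, Complex.ofReal_im, Complex.mul_re, Complex.mul_im,
      Complex.I_re, Complex.I_im]
    simp only [mul_zero, mul_one, sub_zero, add_zero, zero_add]
    nlinarith [Real.sin_sq_add_cos_sq b]
  rw [h3, h2, mul_sub (4 * Real.exp a), h1]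
  ring

/-- With π sinh ζ = a + ib, the squared modulus is 4eᵃ(cosh²(a/2) - sin²(b/2)), and sin²(b/2) ≤
cosh²(a/2) sin²((π/2) sin y) lets cosh²(a/2) be factored out. -/
theorem le_norm_one_add_exp_pi_mul_sinh (x y : ℝ) :
    (1 + Real.exp (Real.pi * Real.sinh x * Real.cos y)) *
        Real.cos (Real.pi / 2 * Real.sin y) ≤
      ‖1 + Complex.exp (Real.pi * Complex.sinh (x + y * Complex.I))‖ := by
  have e : (Real.pi : ℂ) * Complex.sinh (x + y * Complex.I) =
      ((Real.pi * Real.sinh x * Real.cos y : ℝ) : ℂ) +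
        ((Real.pi * Real.cosh x * Real.sin y : ℝ) : ℂ) * Complex.I := by
    rw [Complex.sinh_add, Complex.sinh_mul_I, Complex.cosh_mul_I]
    push_cast
    ring
  rw [e]
  refine le_of_sq_le_sq ?_ (norm_nonneg _)
  rw [← Complex.normSq_eq_norm_sq, normSq_one_add_exp]
  set a := Real.pi * Real.sinh x * Real.cos y
  have h1 := four_mul_exp_mul_cosh_sq a
  rw [mul_pow, ← h1, Real.cos_sq', mul_assoc]
  have := sq_sin_pi_div_two_mul_cosh_mul_sin_le x y
  have h4 : 0 ≤ 4 * Real.exp a := by positivity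
  apply mul_le_mul_of_nonneg_left _ h4
  linarith

theorem exp_mul_abs_le_rpow_mul_rpow {α β μ : ℝ} (hμ : 0 ≤ μ) (hα : μ ≤ α) (hβ : μ ≤ β) (a : ℝ) :
    Real.exp (μ * |a|) ≤ (1 + Real.exp (-a)) ^ α * (1 + Real.exp a) ^ β := by
  have aux : ∀ {γ δ : ℝ}, μ ≤ γ → μ ≤ δ → ∀ b : ℝ, 0 ≤ b →
      Real.exp (μ * b) ≤ (1 + Real.exp (-b)) ^ γ * (1 + Real.exp b) ^ δ := by
    intro γ δ hγ hδ b hb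
    have h1 : 1 ≤ (1 + Real.exp (-b)) ^ γ :=
      Real.one_le_rpow (by have := Real.exp_pos (-b); linarith) (hμ.trans hγ)
    have h2 : Real.exp (μ * b) ≤ (1 + Real.exp b) ^ δ := by
      calc Real.exp (μ * b) ≤ Real.exp (b * δ) := by
            rw [mul_comm b]
            gcongr
        _ = Real.exp b ^ δ := Real.exp_mul _ _
        _ ≤ _ := Real.rpow_le_rpow (Real.exp_pos _).le (by linarith) (hμ.trans hδ)
    calc Real.exp (μ * b) = 1 * Real.exp (μ * b) := (one_mul _).symm
      _ ≤ _ := mul_le_mul h1 h2 (Real.exp_pos _).le (zero_le_one.trans h1)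
  rcases le_total 0 a with h | h
  · rw [abs_of_nonneg h]
    exact aux hα hβ a h
  · rw [abs_of_nonpos h]
    have := aux hβ hα (-a) (by linarith)
    rwa [neg_neg, mul_comm ((1 + Real.exp a) ^ β)] at this

/-! ### Tail sums of double exponentials -/

theorem mul_sub_le_sinh_sub_sinh {a b : ℝ} (ha : 0 ≤ a) (hab : a ≤ b) :
    Real.sinh a * (b - a) ≤ Real.sinh b - Real.sinh a := by
  have h1 : b - a ≤ Real.sinh (b - a) := Real.self_le_sinh_iff.2 (by linarith)
  have h2 := Real.one_le_cosh (b - a)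
  have h3 : Real.sinh b = Real.sinh (b - a) * Real.cosh a + Real.cosh (b - a) * Real.sinh a := by
    rw [← Real.sinh_add]; ring_nf
  have h4 := (Real.sinh_lt_cosh a).le
  have h5 : 0 ≤ Real.sinh a := Real.sinh_nonneg_iff.2 ha
  have h6 : (b - a) * Real.sinh a ≤ Real.sinh (b - a) * Real.cosh a :=
    mul_le_mul h1 h4 h5 (by linarith)
  nlinarith

/-- A discrete counterpart of `∫_a^∞ exp (-c sinh t) dt ≤ exp (-c sinh a) / (c sinh a)`. -/
theorem mul_sum_exp_neg_sinh_le {c h a A : ℝ} (hc : 0 ≤ c) (hh : 0 ≤ h) (ha : 0 ≤ a)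
    (hA : A ≤ c * h * Real.sinh a) (p : ℕ) :
    A * ∑ k ∈ Finset.range p, Real.exp (-(c * Real.sinh (a + (k + 1) * h))) ≤
      Real.exp (-(c * Real.sinh a)) - Real.exp (-(c * Real.sinh (a + p * h))) := by
  induction p with
  | zero => simp
  | succ p ih =>
    rw [Finset.sum_range_succ, mul_add]
    push_cast
    set u := a + p * h with hu
    set v := a + (p + 1) * h with hv
    have hau : a ≤ u := by rw [hu]; nlinarith [mul_nonneg (Nat.cast_nonneg (α := ℝ) p) hh]
    have hvu : v - u = h := by rw [hu, hv]; ring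
    have h1 := mul_sub_le_sinh_sub_sinh (ha.trans hau) (show u ≤ v by linarith)
    have h2 : A ≤ c * (Real.sinh v - Real.sinh u) := by
      have : Real.sinh a ≤ Real.sinh u := Real.sinh_le_sinh.2 hau
      rw [hvu] at h1
      calc A ≤ c * h * Real.sinh a := hA
        _ ≤ c * h * Real.sinh u := by gcongr
        _ = c * (Real.sinh u * h) := by ring
        _ ≤ _ := by gcongr
    -- Since 1 + A ≤ exp(c(sinh v - sinh u)), A times the new term is at most the drop of exp(-c
    -- sinh) from u to v, so the sum telescopes.
    have h3 := Real.add_one_le_exp (c * (Real.sinh v - Real.sinh u))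
    have h4 : Real.exp (-(c * Real.sinh u)) =
        Real.exp (-(c * Real.sinh v)) * Real.exp (c * (Real.sinh v - Real.sinh u)) := by
      rw [← Real.exp_add]; ring_nf
    have h5 : Real.exp (-(c * Real.sinh v)) * (A + 1) ≤
        Real.exp (-(c * Real.sinh v)) * Real.exp (c * (Real.sinh v - Real.sinh u)) :=
      mul_le_mul_of_nonneg_left (by linarith) (Real.exp_pos _).le
    linarith

/-! ### Size of the complex sine and of the exponential integral -/

theorem normSq_sin_add_mul_I (a b : ℝ) :
    Complex.normSq (Complex.sin (a + b * Complex.I)) = Real.sin a ^ 2 + Real.sinh b ^ 2 := by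
  rw [Complex.sin_add_mul_I, ← Complex.ofReal_sin, ← Complex.ofReal_cos, ← Complex.ofReal_sinh,
    ← Complex.ofReal_cosh, ← Complex.ofReal_mul, ← Complex.ofReal_mul, Complex.normSq_add_mul_I,
    mul_pow, mul_pow, Real.cosh_sq, Real.cos_sq']
  ring

theorem abs_sinh_le_norm_sin (a b : ℝ) :
    |Real.sinh b| ≤ ‖Complex.sin (a + b * Complex.I)‖ := by
  refine abs_le_of_sq_le_sq' ?_ (norm_nonneg _) |> abs_le.2
  rw [← Complex.normSq_eq_norm_sq, normSq_sin_add_mul_I]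
  nlinarith [sq_nonneg (Real.sin a)]

theorem one_le_norm_sin {a : ℝ} (ha : Real.cos a = 0) (b : ℝ) :
    1 ≤ ‖Complex.sin (a + b * Complex.I)‖ := by
  refine le_of_sq_le_sq ?_ (norm_nonneg _)
  rw [← Complex.normSq_eq_norm_sq, normSq_sin_add_mul_I, Real.sin_sq, ha]
  nlinarith [sq_nonneg (Real.sinh b)]

theorem integral_exp_neg_mul_abs_le {c : ℝ} (hc : 0 < c) {T : ℝ} (hT : 0 ≤ T) :
    ∫ t in (-T)..T, Real.exp (-(c * |t|)) ≤ 2 / c := by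
  have hi : ∀ u v : ℝ,
      IntervalIntegrable (fun t => Real.exp (-(c * |t|))) MeasureTheory.volume u v :=
    fun u v => Continuous.intervalIntegrable (by fun_prop) _ _
  have h1 : ∫ t in (0)..T, Real.exp (-(c * |t|)) ≤ 1 / c := by
    have e : ∫ t in (0)..T, Real.exp (-(c * |t|)) = ∫ t in (0)..T, Real.exp (-c * t) := by
      apply intervalIntegral.integral_congr
      intro t ht
      rw [Set.uIcc_of_le hT] at ht
      change Real.exp (-(c * |t|)) = Real.exp (-c * t)
      rw [abs_of_nonneg ht.1, neg_mul]
    have hd : ∀ t ∈ Set.uIcc 0 T,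
        HasDerivAt (fun t => -(Real.exp (-c * t) / c)) (Real.exp (-c * t)) t := by
      intro t _
      have := (((hasDerivAt_id t).const_mul (-c)).exp.div_const c).neg
      refine this.congr_deriv ?_
      rw [id, mul_one, mul_neg, neg_div, neg_neg, mul_div_assoc, div_self hc.ne', mul_one]
    rw [e, intervalIntegral.integral_eq_sub_of_hasDerivAt hd
      (Continuous.intervalIntegrable (by fun_prop) _ _)]
    have := div_pos (Real.exp_pos (-c * T)) hc
    simp only [mul_zero, Real.exp_zero]
    linarith
  have h2 : ∫ t in (-T)..0, Real.exp (-(c * |t|)) = ∫ t in (0)..T, Real.exp (-(c * |t|)) := by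
    have := intervalIntegral.integral_comp_neg (a := 0) (b := T)
      (fun t => Real.exp (-(c * |t|)))
    simp only [abs_neg, neg_zero] at this
    exact this.symm
  rw [← intervalIntegral.integral_add_adjacent_intervals (hi (-T) 0) (hi 0 T), h2]
  have : 2 / c = 1 / c + 1 / c := by ring
  linarith

/-! ### Residue theorem on a rectangle -/

open Complex in
/-- The integral of `f` along the boundary of the rectangle `[-T, T] × [-y, y]`, taken
counterclockwise. -/
noncomputable def rectIntegral (f : ℂ → ℂ) (T y : ℝ) : ℂ :=
  (∫ x : ℝ in (-T)..T, f (x + (-y : ℝ) * I)) - (∫ x : ℝ in (-T)..T, f (x + y * I)) +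
    I * (∫ v : ℝ in (-y)..y, f (T + v * I)) - I * (∫ v : ℝ in (-y)..y, f ((-T : ℝ) + v * I))

/-- The rectangle `[-T, T] × [-y, y]`. -/
def rectBox (T y : ℝ) : Set ℂ := {z : ℂ | |z.re| ≤ T ∧ |z.im| ≤ y}

theorem rectIntegral_eq_zero {f : ℂ → ℂ} {T y : ℝ} (hT : 0 ≤ T) (hy : 0 ≤ y)
    (hf : ∀ z ∈ rectBox T y, AnalyticAt ℂ f z) : rectIntegral f T y = 0 := by
  have := Complex.integral_boundary_rect_eq_zero_of_differentiableOn f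
    ⟨-T, -y⟩ ⟨T, y⟩ (by
      intro z hz
      rw [Complex.mem_reProdIm, Set.uIcc_of_le (by simpa using hT), Set.uIcc_of_le (by simpa using hy)] at hz
      exact (hf z ⟨abs_le.2 hz.1, abs_le.2 hz.2⟩).differentiableAt.differentiableWithinAt)
  simpa only [rectIntegral, smul_eq_mul] using this

open Complex in
theorem integral_div_affine {u w : ℂ} {a b : ℝ} (hab : a ≤ b)
    (h : ∀ t ∈ Set.Icc a b, u + t * w ∈ slitPlane) :
    ∫ t : ℝ in a..b, w / (u + t * w) = log (u + b * w) - log (u + a * w) := by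
  refine intervalIntegral.integral_eq_sub_of_hasDerivAt
    (f := fun t : ℝ => log (u + t * w)) (fun t ht => ?_) ?_
  · rw [Set.uIcc_of_le hab] at ht
    have h1 : HasDerivAt (fun t : ℝ => u + (t : ℂ) * w) w t := by
      have := ((hasDerivAt_id t).ofReal_comp.mul_const w).const_add u
      simpa using this
    exact h1.clog_real (h t ht)
  · apply ContinuousOn.intervalIntegrable
    rw [Set.uIcc_of_le hab]
    refine ContinuousOn.div (by fun_prop) (by fun_prop) fun t ht => ?_
    exact slitPlane_ne_zero (h t ht)

open Complex in
theorem log_neg_of_im_pos {z : ℂ} (h : 0 < z.im) : log (-z) = log z - Real.pi * I := by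
  rw [log, log, norm_neg, arg_neg_eq_arg_sub_pi_of_im_pos h]
  push_cast
  ring

open Complex in
theorem log_neg_of_im_neg {z : ℂ} (h : z.im < 0) : log (-z) = log z + Real.pi * I := by
  rw [log, log, norm_neg, arg_neg_eq_arg_add_pi_of_im_neg h]
  push_cast
  ring

-- The principal logarithm is a primitive on three sides. The left side crosses its cut, so log(a -
-- z) is used there; the mismatch of πi at each left corner adds up to 2πi.
open Complex in
theorem rectIntegral_inv_sub {T y a : ℝ} (hy : 0 < y) (ha : |a| < T) :
    rectIntegral (fun z => (z - a)⁻¹) T y = 2 * Real.pi * I := by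
  obtain ⟨ha1, ha2⟩ := abs_lt.1 ha
  have hT : -T ≤ T := by linarith
  have e1 : ∫ x : ℝ in (-T)..T, ((x + (-y : ℝ) * I) - (a : ℂ))⁻¹ =
      log (T - a - y * I) - log (-(T + a + y * I)) := by
    have := integral_div_affine (u := -a - y * I) (w := 1) hT
      (fun t _ => by right; simp [hy.ne'])
    convert this using 3
    · simp only [one_div, mul_one]
      congr 1
      push_cast
      ring
    · ring
    · push_cast
      ring
  have e2 : ∫ x : ℝ in (-T)..T, ((x + y * I) - (a : ℂ))⁻¹ =
      log (T - a + y * I) - log (-(T + a - y * I)) := by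
    have := integral_div_affine (u := -a + y * I) (w := 1) hT
      (fun t _ => by right; simp [hy.ne'])
    convert this using 3
    · simp only [one_div, mul_one]
      congr 1
      ring
    · ring
    · push_cast
      ring
  have e3 : I * ∫ v : ℝ in (-y)..y, ((T + v * I) - (a : ℂ))⁻¹ =
      log (T - a + y * I) - log (T - a - y * I) := by
    have := integral_div_affine (u := T - a) (w := I) (show -y ≤ y by linarith)
      (fun t _ => by left; simp [ha2])
    rw [← intervalIntegral.integral_const_mul]
    refine (intervalIntegral.integral_congr fun v _ => ?_).trans (this.trans ?_)
    · change I * ((T + v * I) - (a : ℂ))⁻¹ = I / (T - a + v * I)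
      rw [div_eq_mul_inv]
      congr 2
      ring
    · push_cast
      ring_nf
  have e4 : I * ∫ v : ℝ in (-y)..y, (((-T : ℝ) + v * I) - (a : ℂ))⁻¹ =
      log (T + a - y * I) - log (T + a + y * I) := by
    have := integral_div_affine (u := T + a) (w := -I) (show -y ≤ y by linarith)
      (fun t _ => by left; simp; linarith)
    rw [← intervalIntegral.integral_const_mul]
    refine (intervalIntegral.integral_congr fun v _ => ?_).trans (this.trans ?_)
    · change I * (((-T : ℝ) + v * I) - (a : ℂ))⁻¹ = -I / (T + a + v * -I)
      rw [neg_div, div_eq_mul_inv, ← mul_neg, ← inv_neg]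
      congr 2
      push_cast
      ring
    · push_cast
      ring_nf
  rw [rectIntegral, e1, e2, e3, e4, log_neg_of_im_pos (by simpa using hy),
    log_neg_of_im_neg (by simpa using hy)]
  ring

-- Only the boundary is involved in the hypotheses, since the functions have poles inside.
open Complex in
theorem rectIntegral_sub_const_mul {f g f₁ : ℂ → ℂ} {T y : ℝ} {c : ℂ} (hT : 0 ≤ T) (hy : 0 ≤ y)
    (hf : ∀ z ∈ rectBox T y, (|z.re| = T ∨ |z.im| = y) → ContinuousAt f z)
    (hg : ∀ z ∈ rectBox T y, (|z.re| = T ∨ |z.im| = y) → ContinuousAt g z)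
    (h : ∀ z ∈ rectBox T y, (|z.re| = T ∨ |z.im| = y) → f₁ z = f z - c * g z) :
    rectIntegral f₁ T y = rectIntegral f T y - c * rectIntegral g T y := by
  have hor : ∀ s : ℝ, |s| = y → ∫ x : ℝ in (-T)..T, f₁ (x + s * I) =
      (∫ x : ℝ in (-T)..T, f (x + s * I)) - c * ∫ x : ℝ in (-T)..T, g (x + s * I) := by
    intro s hs
    have mem : ∀ x ∈ Set.uIcc (-T) T, (x + s * I : ℂ) ∈ rectBox T y ∧
        (|(x + s * I : ℂ).re| = T ∨ |(x + s * I : ℂ).im| = y) := by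
      intro x hx
      rw [Set.uIcc_of_le (by linarith)] at hx
      exact ⟨⟨by simpa using abs_le.2 hx, by simpa using hs.le⟩, by right; simpa using hs⟩
    have int : ∀ k : ℂ → ℂ,
        (∀ z ∈ rectBox T y, (|z.re| = T ∨ |z.im| = y) → ContinuousAt k z) →
        IntervalIntegrable (fun x : ℝ => k (x + s * I)) MeasureTheory.volume (-T) T := by
      intro k hk
      refine ContinuousOn.intervalIntegrable fun x hx => ContinuousAt.continuousWithinAt ?_
      exact ContinuousAt.comp' (hk _ (mem x hx).1 (mem x hx).2) (by fun_prop)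
    rw [← intervalIntegral.integral_const_mul, ← intervalIntegral.integral_sub (int f hf)
      ((int g hg).const_mul c)]
    exact intervalIntegral.integral_congr fun x hx => h _ (mem x hx).1 (mem x hx).2
  have ver : ∀ s : ℝ, |s| = T → ∫ v : ℝ in (-y)..y, f₁ (s + v * I) =
      (∫ v : ℝ in (-y)..y, f (s + v * I)) - c * ∫ v : ℝ in (-y)..y, g (s + v * I) := by
    intro s hs
    have mem : ∀ x ∈ Set.uIcc (-y) y, (s + x * I : ℂ) ∈ rectBox T y ∧
        (|(s + x * I : ℂ).re| = T ∨ |(s + x * I : ℂ).im| = y) := by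
      intro x hx
      rw [Set.uIcc_of_le (by linarith)] at hx
      exact ⟨⟨by simpa using hs.le, by simpa using abs_le.2 hx⟩, by left; simpa using hs⟩
    have int : ∀ k : ℂ → ℂ,
        (∀ z ∈ rectBox T y, (|z.re| = T ∨ |z.im| = y) → ContinuousAt k z) →
        IntervalIntegrable (fun x : ℝ => k (s + x * I)) MeasureTheory.volume (-y) y := by
      intro k hk
      refine ContinuousOn.intervalIntegrable fun x hx => ContinuousAt.continuousWithinAt ?_
      exact ContinuousAt.comp' (hk _ (mem x hx).1 (mem x hx).2) (by fun_prop)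
    rw [← intervalIntegral.integral_const_mul, ← intervalIntegral.integral_sub (int f hf)
      ((int g hg).const_mul c)]
    exact intervalIntegral.integral_congr fun x hx => h _ (mem x hx).1 (mem x hx).2
  simp only [rectIntegral]
  rw [hor _ (by rw [abs_neg, abs_of_nonneg hy]), hor _ (abs_of_nonneg hy),
    ver _ (abs_of_nonneg hT), ver _ (by rw [abs_neg, abs_of_nonneg hT])]
  ring

theorem analyticAt_dslope {g : ℂ → ℂ} {a : ℂ} (hg : AnalyticAt ℂ g a) :
    AnalyticAt ℂ (dslope g a) a := by
  obtain ⟨p, hp⟩ := hg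
  exact hp.has_fpower_series_dslope_fslope.analyticAt

/-- The residue theorem for a rectangle and finitely many simple poles on the real axis. -/
theorem rectIntegral_eq_sum_residues {T y : ℝ} (hT : 0 < T) (hy : 0 < y) (r : ℝ → ℂ)
    (P : Finset ℝ) : ∀ f : ℂ → ℂ, (∀ a ∈ P, |a| < T) →
    (∀ z ∈ rectBox T y, (∀ a ∈ P, z ≠ (a : ℂ)) → AnalyticAt ℂ f z) →
    (∀ a ∈ P, ∃ g : ℂ → ℂ, AnalyticAt ℂ g a ∧ g a = r a ∧
      ∀ᶠ z in nhdsWithin (a : ℂ) {(a : ℂ)}ᶜ, f z = g z / (z - a)) →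
    rectIntegral f T y = 2 * Real.pi * Complex.I * ∑ a ∈ P, r a := by
  induction P using Finset.induction_on with
  | empty =>
    intro f _ hf _
    simp [rectIntegral_eq_zero hT.le hy.le fun z hz => hf z hz (by simp)]
  | insert a P haP ih =>
    intro f hP hf hres
    obtain ⟨g, hg, hga, hfg⟩ := hres a (Finset.mem_insert_self a P)
    -- Subtract the polar part at a. Near a the rest is (g(z) - g(a))/(z - a), whose removable
    -- singularity `dslope` fills, so f₁ has one pole fewer.
    set f₁ : ℂ → ℂ := Function.update (fun z => f z - r a * (z - a)⁻¹) (a : ℂ) (dslope g a a)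
      with hf₁
    have hne : ∀ z : ℂ, z ≠ a → f₁ z = f z - r a * (z - a)⁻¹ := fun z hz => by
      rw [hf₁, Function.update_of_ne hz]
    have hev : ∀ z : ℂ, z ≠ a → f₁ =ᶠ[nhds z] fun z => f z - r a * (z - a)⁻¹ := fun z hz =>
      (eventually_ne_nhds hz).mono fun w hw => hne w hw
    have hinv : ∀ z : ℂ, z ≠ a → AnalyticAt ℂ (fun z : ℂ => r a * (z - a)⁻¹) z := fun z hz =>
      analyticAt_const.mul ((analyticAt_id.sub analyticAt_const).inv (sub_ne_zero.2 hz))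
    have hf₁a : f₁ =ᶠ[nhds (a : ℂ)] dslope g a := by
      rw [Filter.EventuallyEq, ← nhdsNE_sup_pure, Filter.eventually_sup]
      refine ⟨?_, by simp [hf₁]⟩
      filter_upwards [hfg, self_mem_nhdsWithin] with z hz hza
      have hza : z ≠ a := hza
      rw [hne z hza, hz, dslope_of_ne _ hza, slope_def_field, hga]
      ring
    have hbd : ∀ z ∈ rectBox T y, (|z.re| = T ∨ |z.im| = y) → ∀ b : ℝ, |b| < T → z ≠ (b : ℂ) := by
      rintro z - hz b hb rfl
      simp only [Complex.ofReal_re, Complex.ofReal_im, abs_zero] at hz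
      rcases hz with h | h
      · exact hb.ne h
      · exact hy.ne h
    have key : rectIntegral f₁ T y = 2 * Real.pi * Complex.I * ∑ a ∈ P, r a := by
      refine ih f₁ (fun b hb => hP b (Finset.mem_insert_of_mem hb)) (fun z hz hzP => ?_)
        fun b hb => ?_
      · by_cases hza : z = a
        · rw [hza]
          exact (analyticAt_dslope hg).congr hf₁a.symm
        · refine AnalyticAt.congr ((hf z hz ?_).sub (hinv z hza)) (hev z hza).symm
          intro b hb
          rcases Finset.mem_insert.1 hb with rfl | hb
          · exact hza
          · exact hzP b hb
      · obtain ⟨k, hk, hkb, hfk⟩ := hres b (Finset.mem_insert_of_mem hb)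
        have hba : (b : ℂ) ≠ a := by
          intro h
          rw [Complex.ofReal_inj] at h
          exact haP (h ▸ hb)
        -- The correction vanishes at b, so the residue there is unchanged.
        refine ⟨fun z => k z - (z - b) * (r a * (z - a)⁻¹),
          hk.sub (((analyticAt_id (𝕜 := ℂ)).sub analyticAt_const).mul (hinv _ hba)), by simp [hkb], ?_⟩
        filter_upwards [hfk, self_mem_nhdsWithin, (hev _ hba).filter_mono nhdsWithin_le_nhds]
          with z hz hzb hz'
        have hzb : z - b ≠ 0 := sub_ne_zero.2 hzb
        rw [hz', hz, sub_div, mul_div_cancel_left₀ _ hzb]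
    have haT := hP a (Finset.mem_insert_self a P)
    have step := rectIntegral_sub_const_mul (f := f) (g := fun z => (z - a)⁻¹) (f₁ := f₁)
      (c := r a) hT.le hy.le
      (fun z hz hz' => (hf z hz fun b hb => hbd z hz hz' b (hP b hb)).continuousAt)
      (fun z hz hz' => by
        have := hbd z hz hz' a haT
        exact (((analyticAt_id (𝕜 := ℂ)).sub analyticAt_const).inv (sub_ne_zero.2 this)).continuousAt)
      (fun z hz hz' => hne z (hbd z hz hz' a haT))
    rw [key, rectIntegral_inv_sub hy haT] at step
    rw [Finset.sum_insert haP]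
    linear_combination -step

/-! ### Decay of F on the strip and on the real line -/

theorem cos_pi_div_two_mul_sin_pos {d : ℝ} (hd : 0 < d) (hd' : d < Real.pi / 2) :
    0 < Real.cos (Real.pi / 2 * Real.sin d) := by
  have hpi := Real.pi_pos
  have h0 : 0 < Real.sin d := Real.sin_pos_of_pos_of_lt_pi hd (by linarith)
  have h1 : Real.sin d < 1 := by
    rw [← Real.sin_pi_div_two]
    exact Real.sin_lt_sin_of_lt_of_le_pi_div_two (by linarith) le_rfl hd'
  exact Real.cos_pos_of_mem_Ioo ⟨by nlinarith, by nlinarith⟩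

theorem cos_le_cos_of_abs_lt {y d : ℝ} (hy : |y| < d) (hd' : d < Real.pi / 2) :
    Real.cos d ≤ Real.cos y := by
  rw [← Real.cos_abs y]
  exact Real.cos_le_cos_of_nonneg_of_le_pi (abs_nonneg y) (by linarith [Real.pi_pos]) hy.le

theorem cos_pi_div_two_mul_sin_le {y d : ℝ} (hy : |y| < d) (hd' : d < Real.pi / 2) :
    Real.cos (Real.pi / 2 * Real.sin d) ≤ Real.cos (Real.pi / 2 * Real.sin y) := by
  have hpi := Real.pi_pos
  obtain ⟨h1, h2⟩ := abs_lt.1 hy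
  have h3 : |Real.sin y| ≤ Real.sin d := by
    rw [abs_le, ← Real.sin_neg]
    exact ⟨Real.sin_le_sin_of_le_of_le_pi_div_two (by linarith) (by linarith) h1.le,
      Real.sin_le_sin_of_le_of_le_pi_div_two (by linarith) hd'.le h2.le⟩
  rw [← Real.cos_abs (Real.pi / 2 * Real.sin y), abs_mul, abs_of_pos (by positivity)]
  refine Real.cos_le_cos_of_nonneg_of_le_pi (by positivity) ?_ (by gcongr)
  nlinarith [Real.sin_le_one d]

/-- Weakening |sinh x| to |x| leaves a single exponential that is uniform in y and integrates
explicitly; its rate is the source of the factor πμ cos d in the constant. -/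
theorem InClass.norm_le {L R α β d : ℝ} {F : ℂ → ℂ} (hF : InClass L R α β d F) (hL : 0 < L)
    (hα : 0 < α) (hβ : 0 < β) (hd : 0 < d) (hd' : d < Real.pi / 2) (x : ℝ) {y : ℝ}
    (hy : |y| < d) :
    ‖F (x + y * Complex.I)‖ ≤ L / Real.cos (Real.pi / 2 * Real.sin d) ^ (α + β) *
      Real.exp (-(Real.pi * min α β * Real.cos d * |x|)) := by
  have hpi := Real.pi_pos
  set C := Real.cos (Real.pi / 2 * Real.sin d) with hC
  have hC0 : 0 < C := cos_pi_div_two_mul_sin_pos hd hd'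
  have hCy := cos_pi_div_two_mul_sin_le hy hd'
  have hcos := cos_le_cos_of_abs_lt hy hd'
  have hcosd : 0 < Real.cos d := Real.cos_pos_of_mem_Ioo ⟨by linarith, hd'⟩
  set a := Real.pi * Real.sinh x * Real.cos y with ha
  have hμ : 0 < min α β := lt_min hα hβ
  have n1 : (1 + Real.exp a) * C ≤
      ‖1 + Complex.exp (Real.pi * Complex.sinh (x + y * Complex.I))‖ := by
    refine le_trans ?_ (le_norm_one_add_exp_pi_mul_sinh x y)
    gcongr
  have n2 : (1 + Real.exp (-a)) * C ≤
      ‖1 + Complex.exp (-(Real.pi * Complex.sinh (x + y * Complex.I)))‖ := by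
    have := le_norm_one_add_exp_pi_mul_sinh (-x) (-y)
    rw [Real.sinh_neg, Real.cos_neg, Real.sin_neg, mul_neg, mul_neg, Real.cos_neg, neg_mul,
      show ((-x : ℝ) : ℂ) + ((-y : ℝ) : ℂ) * Complex.I = -(x + y * Complex.I) by push_cast; ring,
      Complex.sinh_neg, mul_neg] at this
    refine le_trans ?_ this
    gcongr
  have hax : Real.pi * Real.cos d * |x| ≤ |a| := by
    have hs : |x| ≤ |Real.sinh x| := by
      rcases le_total 0 x with h | h
      · exact abs_le_abs_of_nonneg h (Real.self_le_sinh_iff.2 h)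
      · exact abs_le_abs_of_nonpos h (Real.sinh_le_self_iff.2 h)
    rw [ha, abs_mul, abs_mul, abs_of_pos hpi, abs_of_pos (hcosd.trans_le hcos)]
    calc Real.pi * Real.cos d * |x| = Real.pi * |x| * Real.cos d := by ring
      _ ≤ _ := by gcongr
  have hden : C ^ (α + β) * Real.exp (Real.pi * min α β * Real.cos d * |x|) ≤
      ‖1 + Complex.exp (-(Real.pi * Complex.sinh (x + y * Complex.I)))‖ ^ α *
      ‖1 + Complex.exp (Real.pi * Complex.sinh (x + y * Complex.I))‖ ^ β := by
    have e1 := exp_mul_abs_le_rpow_mul_rpow hμ.le (min_le_left α β) (min_le_right α β) a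
    have p1 : 0 < 1 + Real.exp (-a) := by positivity
    have p2 : 0 < 1 + Real.exp a := by positivity
    calc C ^ (α + β) * Real.exp (Real.pi * min α β * Real.cos d * |x|)
        ≤ C ^ (α + β) * ((1 + Real.exp (-a)) ^ α * (1 + Real.exp a) ^ β) := by
          gcongr
          refine le_trans (Real.exp_le_exp.2 ?_) e1
          calc _ = min α β * (Real.pi * Real.cos d * |x|) := by ring
            _ ≤ _ := by gcongr
      _ = ((1 + Real.exp (-a)) * C) ^ α * ((1 + Real.exp a) * C) ^ β := by
          rw [Real.mul_rpow p1.le hC0.le, Real.mul_rpow p2.le hC0.le, Real.rpow_add hC0]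
          ring
      _ ≤ _ := by gcongr
  refine (hF.bound_strip (x + y * Complex.I) (by simpa [strip] using hy)).trans ?_
  rw [Real.exp_neg, ← div_eq_mul_inv, div_div]
  exact div_le_div_of_nonneg_left hL.le (by positivity) hden

theorem InClass.norm_ofReal_le {L R α β d : ℝ} {F : ℂ → ℂ} (hF : InClass L R α β d F)
    (hR : 0 < R) (hα : 0 < α) (hβ : 0 < β) (x : ℝ) :
    ‖F x‖ ≤ R * Real.exp (-(Real.pi * β * Real.sinh x)) ∧
      ‖F x‖ ≤ R * Real.exp (-(Real.pi * α * Real.sinh (-x))) := by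
  have aux : ∀ {γ δ : ℝ}, 0 < γ → 0 < δ → ∀ s : ℝ,
      Real.exp (s * δ) ≤ (1 + Real.exp (-s)) ^ γ * (1 + Real.exp s) ^ δ := by
    intro γ δ hγ hδ s
    have h1 : 1 ≤ (1 + Real.exp (-s)) ^ γ :=
      Real.one_le_rpow (by have := Real.exp_pos (-s); linarith) hγ.le
    rw [Real.exp_mul]
    have h2 : Real.exp s ^ δ ≤ (1 + Real.exp s) ^ δ :=
      Real.rpow_le_rpow (Real.exp_pos _).le (by linarith) hδ.le
    calc _ ≤ (1 + Real.exp s) ^ δ := h2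
      _ ≤ _ := le_mul_of_one_le_left (by positivity) h1
  have hb := hF.bound_real x
  constructor
  · refine hb.trans ?_
    rw [Real.exp_neg (Real.pi * β * _), ← div_eq_mul_inv]
    refine div_le_div_of_nonneg_left hR.le (by positivity) ?_
    rw [show Real.pi * β * Real.sinh x = Real.pi * Real.sinh x * β by ring]
    exact aux hα hβ _
  · refine hb.trans ?_
    rw [Real.exp_neg (Real.pi * α * _), ← div_eq_mul_inv]
    refine div_le_div_of_nonneg_left hR.le (by positivity) ?_
    have := aux hβ hα (-(Real.pi * Real.sinh x))
    rw [neg_neg, mul_comm ((1 + Real.exp (Real.pi * Real.sinh x)) ^ β)] at this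
    rwa [Real.sinh_neg, show Real.pi * α * -Real.sinh x = -(Real.pi * Real.sinh x) * α by ring]

/-! ### Truncation error -/

theorem sum_Icc_neg_add (w : ℤ → ℂ) (M N p p' : ℕ) :
    ∑ k ∈ Finset.Icc (-((M + p' : ℕ) : ℤ)) ((N + p : ℕ) : ℤ), w k =
      ∑ k ∈ Finset.Icc (-(M : ℤ)) N, w k + ∑ i ∈ Finset.range p, w (N + i + 1) +
        ∑ i ∈ Finset.range p', w (-(M + i + 1)) := by
  induction p' with
  | zero =>
    simp only [add_zero, Finset.range_zero, Finset.sum_empty]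
    induction p with
    | zero => simp
    | succ p ih =>
      have : Finset.Icc (-(M : ℤ)) ((N + (p + 1) : ℕ) : ℤ) =
          insert ((N : ℤ) + p + 1) (Finset.Icc (-(M : ℤ)) ((N + p : ℕ) : ℤ)) := by
        ext k
        simp only [Finset.mem_insert, Finset.mem_Icc]
        omega
      rw [this, Finset.sum_insert (by simp), ih, Finset.sum_range_succ]
      ring
  | succ p' ih =>
    have : Finset.Icc (-((M + (p' + 1) : ℕ) : ℤ)) ((N + p : ℕ) : ℤ) =
        insert (-((M : ℤ) + p' + 1)) (Finset.Icc (-((M + p' : ℕ) : ℤ)) ((N + p : ℕ) : ℤ)) := by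
      ext k
      simp only [Finset.mem_insert, Finset.mem_Icc]
      omega
    rw [this, Finset.sum_insert (by simp), ih, Finset.sum_range_succ]
    ring

theorem norm_sinc_le_one (x : ℝ) : ‖(sinc x : ℂ)‖ ≤ 1 := by
  rw [Complex.norm_real, Real.norm_eq_abs, sinc]
  exact Real.abs_sinc_le_one _

theorem norm_sincSum_sub_le (F : ℂ → ℂ) (h x : ℝ) (M N p p' : ℕ) :
    ‖sincSum F h ((M + p' : ℕ) : ℤ) ((N + p : ℕ) : ℤ) x - sincSum F h M N x‖ ≤
      ∑ i ∈ Finset.range p, ‖F ((N * h + (i + 1) * h : ℝ) : ℂ)‖ +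
        ∑ i ∈ Finset.range p', ‖F ((-(M * h + (i + 1) * h) : ℝ) : ℂ)‖ := by
  rw [sincSum, sincSum, sum_Icc_neg_add, add_assoc, add_sub_cancel_left]
  have aux : ∀ (z : ℂ) (t : ℝ), ‖z * (sinc t : ℂ)‖ ≤ ‖z‖ := fun z t => by
    rw [norm_mul]
    exact mul_le_of_le_one_right (norm_nonneg _) (norm_sinc_le_one t)
  refine (norm_add_le _ _).trans (add_le_add ?_ ?_)
  · refine (norm_sum_le _ _).trans (Finset.sum_le_sum fun i _ => (aux _ _).trans (le_of_eq ?_))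
    congr 3
    push_cast
    ring
  · refine (norm_sum_le _ _).trans (Finset.sum_le_sum fun i _ => (aux _ _).trans (le_of_eq ?_))
    congr 3
    push_cast
    ring

theorem sum_norm_le_of_exp_neg_sinh {f : ℕ → ℝ} {R c h a A E : ℝ} (hR : 0 ≤ R) (hc : 0 ≤ c)
    (hh : 0 ≤ h) (ha : 0 ≤ a) (hA0 : 0 < A) (hA : A ≤ c * h * Real.sinh a)
    (hE : Real.exp (-(c * Real.sinh a)) ≤ E)
    (hf : ∀ i, f i ≤ R * Real.exp (-(c * Real.sinh (a + (i + 1) * h)))) (p : ℕ) :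
    ∑ i ∈ Finset.range p, f i ≤ R / A * E := by
  have h1 := mul_sum_exp_neg_sinh_le hc hh ha hA p
  have h2 : A * ∑ k ∈ Finset.range p, Real.exp (-(c * Real.sinh (a + (k + 1) * h))) ≤ E := by
    have := Real.exp_pos (-(c * Real.sinh (a + p * h)))
    linarith
  calc ∑ i ∈ Finset.range p, f i
      ≤ ∑ i ∈ Finset.range p, R * Real.exp (-(c * Real.sinh (a + (i + 1) * h))) :=
        Finset.sum_le_sum fun i _ => hf i
    _ = R / A * (A * ∑ k ∈ Finset.range p, Real.exp (-(c * Real.sinh (a + (k + 1) * h)))) := by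
        rw [← Finset.mul_sum, ← mul_assoc, div_mul_cancel₀ _ hA0.ne']
    _ ≤ R / A * E := by gcongr

/-- The truncation error of the sinc series, uniformly in the length of the longer sum. -/
theorem InClass.norm_sincSum_sub_le {L R α β d : ℝ} {F : ℂ → ℂ} (hF : InClass L R α β d F)
    (hR : 0 < R) (hα : 0 < α) (hβ : 0 < β) (hd : 0 < d) {μ Q h : ℝ} (hμ : 0 < μ) (hQ : 0 < Q)
    (hh : h = d / (μ * Q)) {M N : ℕ} (hM : μ / α * Q ≤ Real.sinh (M * h))
    (hN : μ / β * Q ≤ Real.sinh (N * h)) (x : ℝ) (p p' : ℕ) :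
    ‖sincSum F h ((M + p' : ℕ) : ℤ) ((N + p : ℕ) : ℤ) x - sincSum F h M N x‖ ≤
      2 * R / (Real.pi * d) * Real.exp (-(Real.pi * μ * Q)) := by
  have hpi := Real.pi_pos
  have hh0 : 0 < h := by rw [hh]; positivity
  have side : ∀ {γ : ℝ}, 0 < γ → ∀ K : ℕ, μ / γ * Q ≤ Real.sinh (K * h) →
      Real.pi * d ≤ Real.pi * γ * h * Real.sinh (K * h) ∧
      Real.exp (-(Real.pi * γ * Real.sinh (K * h))) ≤ Real.exp (-(Real.pi * μ * Q)) := by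
    intro γ hγ K hK
    constructor
    -- The choice of h makes hμQ = d, so both tails share the value A = πd whatever γ is.
    · calc Real.pi * d = Real.pi * γ * h * (μ / γ * Q) := by
            rw [hh]
            field_simp
        _ ≤ _ := by gcongr
    · apply Real.exp_le_exp.2
      have : Real.pi * μ * Q = Real.pi * γ * (μ / γ * Q) := by field_simp
      rw [this]
      gcongr
  obtain ⟨a1, a2⟩ := side hβ N hN
  obtain ⟨b1, b2⟩ := side hα M hM
  have t1 := sum_norm_le_of_exp_neg_sinh (f := fun i : ℕ => ‖F ((N * h + (i + 1) * h : ℝ) : ℂ)‖)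
    hR.le (by positivity) hh0.le (by positivity) (by positivity) a1 a2
    (fun i => (hF.norm_ofReal_le hR hα hβ _).1) p
  have t2 := sum_norm_le_of_exp_neg_sinh
    (f := fun i : ℕ => ‖F ((-(M * h + (i + 1) * h) : ℝ) : ℂ)‖)
    hR.le (by positivity) hh0.le (by positivity) (by positivity) b1 b2
    (fun i => by
      have := (hF.norm_ofReal_le hR hα hβ (-(M * h + (i + 1) * h))).2
      rwa [neg_neg] at this) p'
  refine (DESinc.norm_sincSum_sub_le F h x M N p p').trans ((add_le_add t1 t2).trans (le_of_eq ?_))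
  ring

/-! ### Discretization error by contour integration -/

theorem sin_pi_mul_div_ofReal (x h : ℝ) :
    Complex.sin (Real.pi * (x : ℂ) / h) = (Real.sin (Real.pi * x / h) : ℂ) := by
  push_cast
  rfl

/-- The error of the symmetric sinc sum as a contour integral. -/
theorem rectIntegral_sinc {F : ℂ → ℂ} {h : ℝ} (hh : 0 < h) {m : ℕ} {x y : ℝ} (hy : 0 < y)
    (hx : |x| < (m + 1 / 2) * h) (hs : Real.sin (Real.pi * x / h) ≠ 0)
    (hF : ∀ z ∈ rectBox ((m + 1 / 2) * h) y, AnalyticAt ℂ F z) :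
    (Real.sin (Real.pi * x / h) : ℂ) *
        rectIntegral (fun z => F z / ((z - x) * Complex.sin (Real.pi * z / h)))
          ((m + 1 / 2) * h) y =
      2 * Real.pi * Complex.I * (F x - sincSum F h m m x) := by
  have hpi := Real.pi_pos
  have hpiC : (Real.pi : ℂ) ≠ 0 := Complex.ofReal_ne_zero.2 hpi.ne'
  have hhC : (h : ℂ) ≠ 0 := Complex.ofReal_ne_zero.2 hh.ne'
  -- The half-integer keeps the vertical sides midway between nodes.
  set T : ℝ := (m + 1 / 2) * h with hTdef
  have hT : 0 < T := by positivity
  set s : ℂ := (Real.sin (Real.pi * x / h) : ℂ) with hsdef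
  have hsC : s ≠ 0 := Complex.ofReal_ne_zero.2 hs
  set S : ℂ → ℂ := fun z => Complex.sin (Real.pi * z / h) with hS
  have hSan : ∀ z, AnalyticAt ℂ S z := fun z =>
    (Differentiable.analyticAt (by fun_prop) z)
  have hSder : ∀ z, deriv S z = Complex.cos (Real.pi * z / h) * (Real.pi / h) := fun z => by
    have h1 : HasDerivAt (fun z : ℂ => Real.pi * z / h) (Real.pi / h : ℂ) z := by
      have := ((hasDerivAt_id z).const_mul (Real.pi : ℂ)).div_const (h : ℂ)
      simpa using this
    exact h1.csin.deriv
  have hnode : ∀ k : ℤ, Real.pi * ((k * h : ℝ) : ℂ) / h = k * Real.pi := fun k => by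
    push_cast
    field_simp
  have hSnode : ∀ k : ℤ, S ((k * h : ℝ) : ℂ) = 0 := fun k => by
    simp only [hS]
    rw [hnode, Complex.sin_int_mul_pi]
  have hcos : ∀ k : ℤ, Complex.cos (k * Real.pi) * Complex.cos (k * Real.pi) = 1 := fun k => by
    have := Complex.sin_sq_add_cos_sq (k * Real.pi)
    rw [Complex.sin_int_mul_pi] at this
    linear_combination this
  have hxk : ∀ k : ℤ, (k : ℝ) * h ≠ x := by
    rintro k rfl
    apply hs
    rw [show Real.pi * (k * h) / h = k * Real.pi by field_simp, Real.sin_int_mul_pi]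
  set r : ℝ → ℂ := fun a => if a = x then F x / s else
    F a / ((a - x) * (Complex.cos (Real.pi * a / h) * (Real.pi / h))) with hr
  have hinj : Function.Injective fun k : ℤ => (k : ℝ) * h := fun a b hab => by
    have := mul_right_cancel₀ hh.ne' hab
    exact_mod_cast this
  set P₀ : Finset ℝ := (Finset.Icc (-(m : ℤ)) m).image fun k : ℤ => (k : ℝ) * h with hP₀
  have hxP : x ∉ P₀ := by
    rw [hP₀, Finset.mem_image]
    rintro ⟨k, -, hk⟩
    exact hxk k hk
  have hnodemem : ∀ k : ℤ, |(k : ℝ) * h| ≤ T → k ∈ Finset.Icc (-(m : ℤ)) m := by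
    intro k hk
    rw [abs_mul, abs_of_pos hh, hTdef] at hk
    have h1 : |(k : ℝ)| ≤ m + 1 / 2 := le_of_mul_le_mul_right hk hh
    have h2 : |(k : ℝ)| < ((m + 1 : ℤ) : ℝ) := by push_cast; linarith
    rw [← Int.cast_abs, Int.cast_lt] at h2
    rw [Finset.mem_Icc]
    exact abs_le.1 (by omega)
  have main := rectIntegral_eq_sum_residues hT hy r (insert x P₀)
    (fun z => F z / ((z - x) * S z)) ?_ ?_ ?_
  · rw [main, Finset.sum_insert hxP, hP₀, Finset.sum_image fun a _ b _ hab => hinj hab]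
    have hrx : r x = F x / s := by simp [hr]
    rw [hrx, sincSum]
    have hterm : ∀ k : ℤ, s * r (k * h) =
        -(F (((k : ℝ) * h : ℝ) : ℂ) * (sinc ((x - (k : ℝ) * h) / h) : ℂ)) := by
      intro k
      have hne : x - k * h ≠ 0 := fun h0 => hxk k (by linarith)
      have hneC : (x : ℂ) - k * h ≠ 0 := by exact_mod_cast hne
      have hneC' : (k : ℂ) * h - x ≠ 0 := by
        rw [← neg_sub]
        exact neg_ne_zero.2 hneC
      have hck : Complex.cos (k * Real.pi) ≠ 0 := left_ne_zero_of_mul (hcos k ▸ one_ne_zero)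
      have hsinc : (sinc ((x - (k : ℝ) * h) / h) : ℂ) =
          s * Complex.cos (k * Real.pi) / (Real.pi * ((x - k * h) / h)) := by
        have hsin : Real.sin (Real.pi * ((x - k * h) / h)) =
            Real.sin (Real.pi * x / h) * Real.cos (k * Real.pi) := by
          rw [show Real.pi * ((x - k * h) / h) = Real.pi * x / h - k * Real.pi by field_simp,
            Real.sin_sub, Real.sin_int_mul_pi, mul_zero, sub_zero]
        rw [sinc, Real.sinc_of_ne_zero (mul_ne_zero hpi.ne' (div_ne_zero hne hh.ne')), hsin,
          Complex.ofReal_div, Complex.ofReal_mul, ← hsdef]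
        push_cast
        rfl
      rw [hsinc, hr]
      simp only [if_neg (hxk k)]
      rw [hnode]
      push_cast
      have hc := hcos k
      set c := Complex.cos (k * Real.pi) with hcdef
      -- cos(kπ) = ±1 is its own inverse, so it can pass from the residue's denominator to the
      -- numerator of sinc.
      have hc' : c = c⁻¹ := eq_inv_of_mul_eq_one_left hc
      have : (x : ℂ) - k * h = -((k : ℂ) * h - x) := by ring
      rw [this]
      nth_rw 2 [hc']
      field_simp
    have : s * (F x / s + ∑ k ∈ Finset.Icc (-(m : ℤ)) m, r (k * h)) =
        F x - ∑ k ∈ Finset.Icc (-(m : ℤ)) m,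
          F (((k : ℝ) * h : ℝ) : ℂ) * (sinc ((x - (k : ℝ) * h) / h) : ℂ) := by
      rw [mul_add, mul_div_cancel₀ _ hsC, Finset.mul_sum, Finset.sum_congr rfl fun k _ => hterm k,
        Finset.sum_neg_distrib]
      ring
    rw [← this]
    ring
  · intro a ha
    rcases Finset.mem_insert.1 ha with rfl | ha
    · exact hx
    · obtain ⟨k, hk, rfl⟩ := Finset.mem_image.1 ha
      rw [Finset.mem_Icc] at hk
      rw [abs_mul, abs_of_pos hh, hTdef]
      have h1 : |(k : ℝ)| ≤ m := by
        rw [← Int.cast_abs]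
        exact_mod_cast abs_le.2 hk
      have h2 : |(k : ℝ)| < m + 1 / 2 := by linarith
      gcongr
  · intro z hz hzP
    have hzx : z - x ≠ 0 := sub_ne_zero.2 (hzP x (Finset.mem_insert_self _ _))
    refine (hF z hz).div ((analyticAt_id.sub analyticAt_const).mul (hSan z)) ?_
    refine mul_ne_zero hzx fun h0 => ?_
    obtain ⟨k, hk⟩ := Complex.sin_eq_zero_iff.1 h0
    have hzk : z = ((k * h : ℝ) : ℂ) := by
      push_cast
      field_simp at hk
      linear_combination hk
    refine hzP (k * h) (Finset.mem_insert_of_mem (Finset.mem_image.2 ⟨k, hnodemem k ?_, rfl⟩)) hzk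
    have := hz.1
    rwa [hzk, Complex.ofReal_re] at this
  · intro a ha
    have hreal : ∀ b : ℝ, |b| ≤ T → AnalyticAt ℂ F (b : ℂ) := fun b hb =>
      hF _ ⟨by simpa using hb, by simpa using hy.le⟩
    rcases Finset.mem_insert.1 ha with rfl | ha
    · refine ⟨fun z => F z / S z, (hreal _ hx.le).div (hSan _) ?_, ?_, ?_⟩
      · simp only [hS]
        rw [sin_pi_mul_div_ofReal]
        exact hsC
      · simp only [hS, hr, if_true]
        rw [sin_pi_mul_div_ofReal]
      · filter_upwards with z
        rw [div_div, mul_comm]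
    · obtain ⟨k, hk, rfl⟩ := Finset.mem_image.1 ha
      have hne : ((k * h : ℝ) : ℂ) - x ≠ 0 := by
        rw [sub_ne_zero]
        exact fun h0 => hxk k (Complex.ofReal_injective h0)
      have hck : Complex.cos (k * Real.pi) ≠ 0 := left_ne_zero_of_mul (hcos k ▸ one_ne_zero)
      have hkT : |(k : ℝ) * h| ≤ T := by
        rw [Finset.mem_Icc] at hk
        rw [abs_mul, abs_of_pos hh, hTdef]
        have h1 : |(k : ℝ)| ≤ m := by
          rw [← Int.cast_abs]
          exact_mod_cast abs_le.2 hk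
        have h2 : |(k : ℝ)| ≤ m + 1 / 2 := by linarith
        gcongr
      -- Dividing the simple zero out of S leaves an analytic factor whose value at the node is S'.
      refine ⟨fun z => F z / ((z - x) * dslope S ((k * h : ℝ) : ℂ) z), ?_, ?_, ?_⟩
      · refine (hreal _ hkT).div ((analyticAt_id.sub analyticAt_const).mul
          (analyticAt_dslope (hSan _))) (mul_ne_zero hne ?_)
        rw [dslope_same, hSder, hnode]
        exact mul_ne_zero hck (div_ne_zero hpiC hhC)
      · simp only [hr, if_neg (hxk k)]
        rw [dslope_same, hSder]
      · filter_upwards [self_mem_nhdsWithin] with z hz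
        have hz : z ≠ ((k * h : ℝ) : ℂ) := hz
        have hz' := sub_ne_zero.2 hz
        rw [dslope_of_ne _ hz, slope_def_field, hSnode, sub_zero, div_div]
        congr 1
        field_simp

/-- At a node the symmetric sinc sum reproduces the function. -/
theorem sincSum_node (F : ℂ → ℂ) {h : ℝ} (hh : 0 < h) {m : ℕ} {j : ℤ}
    (hj : j ∈ Finset.Icc (-(m : ℤ)) m) :
    sincSum F h m m (j * h) = F ((j * h : ℝ) : ℂ) := by
  rw [sincSum, Finset.sum_eq_single_of_mem j hj]
  · simp [sinc]
  · intro k _ hkj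
    have e : Real.pi * ((j * h - k * h) / h) = ((j - k : ℤ) : ℝ) * Real.pi := by
      push_cast
      field_simp
    have : sinc ((j * h - k * h) / h) = 0 := by
      rw [sinc, e, Real.sinc_of_ne_zero, Real.sin_int_mul_pi, zero_div]
      refine mul_ne_zero (Int.cast_ne_zero.2 ?_) Real.pi_ne_zero
      omega
    rw [this, Complex.ofReal_zero, mul_zero]

/-- The first term comes from the horizontal sides. On the vertical ones |sin| ≥ 1 and |z - x| ≥ 1,
so only the decay of F remains and that term tends to 0 with growing m. -/
theorem norm_rectIntegral_sinc_le {F : ℂ → ℂ} {h K c : ℝ} (hh : 0 < h) (hc : 0 < c)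
    {m : ℕ} {x y : ℝ} (hy : 0 < y)
    (hx : |x| + 1 ≤ (m + 1 / 2) * h)
    (hF : ∀ t s : ℝ, |s| ≤ y → ‖F (t + s * Complex.I)‖ ≤ K * Real.exp (-(c * |t|))) :
    ‖rectIntegral (fun z => F z / ((z - x) * Complex.sin (Real.pi * z / h)))
          ((m + 1 / 2) * h) y‖ ≤
      4 * K / (c * (y * Real.sinh (Real.pi * y / h))) +
        4 * y * K * Real.exp (-(c * ((m + 1 / 2) * h))) := by
  have hpi := Real.pi_pos
  set T : ℝ := (m + 1 / 2) * h with hTdef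
  have hT : 0 < T := by positivity
  have hK : 0 ≤ K := by
    have := (norm_nonneg _).trans (hF 0 0 (by simpa using hy.le))
    simpa using this
  set W := Real.sinh (Real.pi * y / h) with hW
  have hW0 : 0 < W := Real.sinh_pos_iff.2 (by positivity)
  have harg : ∀ t s : ℝ, (Real.pi : ℂ) * (t + s * Complex.I) / h =
      ((Real.pi * t / h : ℝ) : ℂ) + ((Real.pi * s / h : ℝ) : ℂ) * Complex.I := fun t s => by
    push_cast
    ring
  have hor : ∀ s : ℝ, |s| = y → ‖∫ t : ℝ in (-T)..T, F (t + s * Complex.I) /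
      ((t + s * Complex.I - x) * Complex.sin (Real.pi * (t + s * Complex.I) / h))‖ ≤
      2 * K / (c * (y * W)) := by
    intro s hs
    have hb : ∀ t : ℝ, ‖F (t + s * Complex.I) /
        ((t + s * Complex.I - x) * Complex.sin (Real.pi * (t + s * Complex.I) / h))‖ ≤
        K / (y * W) * Real.exp (-(c * |t|)) := by
      intro t
      rw [norm_div, norm_mul, harg, div_mul_eq_mul_div]
      have h1 : y ≤ ‖(t + s * Complex.I - x : ℂ)‖ := by
        rw [← hs]
        have := Complex.abs_im_le_norm (t + s * Complex.I - x : ℂ)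
        simpa using this
      have h2 : W ≤ ‖Complex.sin (((Real.pi * t / h : ℝ) : ℂ) +
          ((Real.pi * s / h : ℝ) : ℂ) * Complex.I)‖ := by
        refine le_trans (le_of_eq ?_) (abs_sinh_le_norm_sin _ _)
        rw [Real.abs_sinh, abs_div, abs_mul, abs_of_pos hpi, abs_of_pos hh, hs]
      exact div_le_div₀ (by positivity) (hF t s hs.le) (by positivity)
        (mul_le_mul h1 h2 hW0.le (by positivity))
    have := intervalIntegral.norm_integral_le_of_norm_le (μ := MeasureTheory.volume)
      (show -T ≤ T by linarith) (Filter.Eventually.of_forall fun t _ => hb t)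
      (Continuous.intervalIntegrable (by fun_prop) _ _)
    refine this.trans ?_
    rw [intervalIntegral.integral_const_mul]
    calc _ ≤ K / (y * W) * (2 / c) := by
          gcongr
          exact integral_exp_neg_mul_abs_le hc hT.le
      _ = _ := by
          field_simp
  have ver : ∀ t : ℝ, |t| = T → ‖Complex.I * ∫ s : ℝ in (-y)..y, F (t + s * Complex.I) /
      ((t + s * Complex.I - x) * Complex.sin (Real.pi * (t + s * Complex.I) / h))‖ ≤
      2 * y * K * Real.exp (-(c * T)) := by
    intro t ht
    rw [norm_mul, Complex.norm_I, one_mul]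
    have hcos : Real.cos (Real.pi * t / h) = 0 := by
      rw [← Real.cos_abs, abs_div, abs_mul, abs_of_pos hpi, abs_of_pos hh, ht, hTdef,
        show Real.pi * ((m + 1 / 2) * h) / h = m * Real.pi + Real.pi / 2 by field_simp,
        Real.cos_add_pi_div_two, Real.sin_nat_mul_pi, neg_zero]
    have := intervalIntegral.norm_integral_le_of_norm_le_const
      (f := fun s : ℝ => F (t + s * Complex.I) /
        ((t + s * Complex.I - x) * Complex.sin (Real.pi * (t + s * Complex.I) / h)))
      (a := -y) (b := y) (C := K * Real.exp (-(c * T))) (fun s hs => by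
        rw [Set.uIoc_of_le (by linarith)] at hs
        have hs' : |s| ≤ y := abs_le.2 ⟨hs.1.le, hs.2⟩
        rw [norm_div, norm_mul, harg]
        have h1 : 1 ≤ ‖(t + s * Complex.I - x : ℂ)‖ := by
          have h3 : |t - x| ≤ ‖(t + s * Complex.I - x : ℂ)‖ := by
            have := Complex.abs_re_le_norm (t + s * Complex.I - x : ℂ)
            simpa using this
          have h4 := abs_sub_abs_le_abs_sub t x
          linarith
        have h2 := one_le_norm_sin hcos (Real.pi * s / h)
        have h5 := hF t s hs'
        rw [ht] at h5
        exact (div_le_self (norm_nonneg _) (one_le_mul_of_one_le_of_one_le h1 h2)).trans h5)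
    refine this.trans (le_of_eq ?_)
    rw [sub_neg_eq_add, abs_of_pos (by linarith)]
    ring
  have b1 := hor (-y) (by rw [abs_neg, abs_of_pos hy])
  have b2 := hor y (abs_of_pos hy)
  have b3 := ver T (abs_of_pos hT)
  have b4 := ver (-T) (by rw [abs_neg, abs_of_pos hT])
  rw [rectIntegral]
  refine (norm_sub_le _ _).trans ?_
  refine (add_le_add_left ((norm_add_le _ _).trans (add_le_add_left (norm_sub_le _ _) _)) _).trans ?_
  calc _ ≤ 2 * K / (c * (y * W)) + 2 * K / (c * (y * W)) + 2 * y * K * Real.exp (-(c * T)) +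
        2 * y * K * Real.exp (-(c * T)) := by gcongr
    _ = _ := by ring

theorem eventually_norm_sub_sincSum_le {F : ℂ → ℂ} {h K c d : ℝ} (hh : 0 < h) (hc : 0 < c)
    {x y : ℝ} (hy : 0 < y) (hyd : y < d) (hF : AnalyticOnNhd ℂ F (strip d))
    (hb : ∀ t s : ℝ, |s| ≤ y → ‖F (t + s * Complex.I)‖ ≤ K * Real.exp (-(c * |t|))) :
    ∀ᶠ m : ℕ in Filter.atTop, 2 * Real.pi * ‖F x - sincSum F h m m x‖ ≤
      4 * K / (c * (y * Real.sinh (Real.pi * y / h))) +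
        4 * y * K * Real.exp (-(c * ((m + 1 / 2) * h))) := by
  have hpi := Real.pi_pos
  have hK : 0 ≤ K := by
    have := (norm_nonneg _).trans (hb 0 0 (by simpa using hy.le))
    simpa using this
  have hW0 : 0 < Real.sinh (Real.pi * y / h) := Real.sinh_pos_iff.2 (by positivity)
  have hlim : Filter.Tendsto (fun m : ℕ => ((m : ℝ) + 1 / 2) * h) Filter.atTop Filter.atTop :=
    (Filter.tendsto_atTop_add_const_right _ _ tendsto_natCast_atTop_atTop).atTop_mul_const hh
  by_cases hs : Real.sin (Real.pi * x / h) = 0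
  -- Here x is a node and the poles merge, but the sum is exact once m ≥ |j|.
  · obtain ⟨j, hj⟩ := Real.sin_eq_zero_iff.1 hs
    have hxj : x = j * h := by
      field_simp at hj
      linarith
    filter_upwards [Filter.eventually_ge_atTop j.natAbs] with m hm
    rw [hxj, sincSum_node F hh (by rw [Finset.mem_Icc]; omega), sub_self, norm_zero, mul_zero]
    positivity
  · filter_upwards [hlim.eventually_ge_atTop (|x| + 1)] with m hm
    have e := rectIntegral_sinc (F := F) hh hy (lt_of_lt_of_le (lt_add_one _) hm) hs
      (fun z hz => hF z (lt_of_le_of_lt hz.2 hyd))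
    have e' := congrArg norm e
    have b := norm_rectIntegral_sinc_le hh hc hy hm hb
    simp only [norm_mul, Complex.norm_I, mul_one, Complex.norm_real, Real.norm_eq_abs,
      abs_of_pos hpi, Complex.norm_ofNat] at e'
    rw [← e']
    exact (mul_le_of_le_one_left (norm_nonneg _) (Real.abs_sin_le_one _)).trans b

/-- First m → ∞ at fixed y < d, then y → d from below, as F is controlled only on the open strip.
The bound E is uniform in large m, so convergence of the infinite series is never needed. -/
theorem norm_sub_sincSum_le {F : ℂ → ℂ} {h K c d E : ℝ} (hh : 0 < h) (hc : 0 < c) (hd : 0 < d)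
    (hF : AnalyticOnNhd ℂ F (strip d))
    (hb : ∀ t s : ℝ, |s| < d → ‖F (t + s * Complex.I)‖ ≤ K * Real.exp (-(c * |t|)))
    {M N : ℤ} {x : ℝ}
    (hE : ∀ᶠ m : ℕ in Filter.atTop, ‖sincSum F h m m x - sincSum F h M N x‖ ≤ E) :
    ‖F x - sincSum F h M N x‖ ≤
      2 * K / (Real.pi * (c * (d * Real.sinh (Real.pi * d / h)))) + E := by
  have hpi := Real.pi_pos
  have step : ∀ y : ℝ, 0 < y → y < d → ‖F x - sincSum F h M N x‖ ≤
      2 * K / (Real.pi * (c * (y * Real.sinh (Real.pi * y / h)))) + E := by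
    intro y hy hyd
    have hW0 : 0 < Real.sinh (Real.pi * y / h) := Real.sinh_pos_iff.2 (by positivity)
    have hlim : Filter.Tendsto (fun m : ℕ => 1 / (2 * Real.pi) *
        (4 * K / (c * (y * Real.sinh (Real.pi * y / h))) +
          4 * y * K * Real.exp (-(c * (((m : ℝ) + 1 / 2) * h)))) + E) Filter.atTop
        (nhds (1 / (2 * Real.pi) * (4 * K / (c * (y * Real.sinh (Real.pi * y / h))) +
          4 * y * K * 0) + E)) := by
      have h1 : Filter.Tendsto (fun m : ℕ => c * (((m : ℝ) + 1 / 2) * h)) Filter.atTop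
          Filter.atTop :=
        ((Filter.tendsto_atTop_add_const_right _ _
          tendsto_natCast_atTop_atTop).atTop_mul_const hh).const_mul_atTop hc
      exact (((Real.tendsto_exp_neg_atTop_nhds_zero.comp h1).const_mul _).const_add _
        |>.const_mul _).add_const _
    have hle := ge_of_tendsto hlim (b := ‖F x - sincSum F h M N x‖) (by
      filter_upwards [hE, eventually_norm_sub_sincSum_le (x := x) hh hc hy hyd hF
        fun t s hs => hb t s (hs.trans_lt hyd)] with m hm1 hm2
      have h3 := norm_sub_le_norm_sub_add_norm_sub (F x) (sincSum F h m m x) (sincSum F h M N x)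
      have h4 : ‖F x - sincSum F h m m x‖ ≤ 1 / (2 * Real.pi) *
        (4 * K / (c * (y * Real.sinh (Real.pi * y / h))) +
          4 * y * K * Real.exp (-(c * (((m : ℝ) + 1 / 2) * h)))) := by
        rw [one_div_mul_eq_div, le_div_iff₀ (by positivity)]
        linarith
      linarith)
    refine hle.trans (le_of_eq ?_)
    field_simp
    ring
  have hW0 : 0 < Real.sinh (Real.pi * d / h) := Real.sinh_pos_iff.2 (by positivity)
  have hcont : ContinuousAt (fun y : ℝ =>
      2 * K / (Real.pi * (c * (y * Real.sinh (Real.pi * y / h)))) + E) d := by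
    refine ContinuousAt.add (ContinuousAt.div (by fun_prop) ?_ (by positivity)) (by fun_prop)
    exact Continuous.continuousAt (by fun_prop)
  refine ge_of_tendsto (hcont.tendsto.mono_left (nhdsWithin_le_nhds (s := Set.Iio d))) ?_
  filter_upwards [self_mem_nhdsWithin, nhdsWithin_le_nhds (lt_mem_nhds hd)] with y h1 h2
  exact step y h2 h1

/-! ### Choice of parameters and conclusion -/

theorem le_sinh_ceil_mul {h z : ℝ} (hh : 0 < h) :
    z ≤ Real.sinh (⌈1 / h * Real.arsinh z⌉ * h) := by
  calc z = Real.sinh (Real.arsinh z) := (Real.sinh_arsinh z).symm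
    _ ≤ _ := by
      apply Real.sinh_le_sinh.2
      calc Real.arsinh z = 1 / h * Real.arsinh z * h := by field_simp
        _ ≤ _ := by
          gcongr
          exact Int.le_ceil _

theorem monotoneOn_of_derivWithin_Ici_nonneg {q : ℝ → ℝ} {a : ℝ}
    (hq : DifferentiableOn ℝ q (Set.Ici a))
    (hq' : ∀ x, a ≤ x → 0 ≤ derivWithin q (Set.Ici a) x) : MonotoneOn q (Set.Ici a) := by
  refine monotoneOn_of_deriv_nonneg (convex_Ici a) hq.continuousOn
    (hq.mono interior_subset) fun x hx => ?_
  rw [interior_Ici] at hx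
  rw [← derivWithin_of_mem_nhds (Ici_mem_nhds hx)]
  exact hq' x (le_of_lt hx)

theorem InClass.norm_sub_sincSum_le {L R α β d : ℝ} {F : ℂ → ℂ} (hF : InClass L R α β d F)
    (hL : 0 < L) (hR : 0 < R) (hα : 0 < α) (hβ : 0 < β) (hd : 0 < d) (hd' : d < Real.pi / 2)
    {μ Q Q₀ h : ℝ} (hμ : μ = min α β) (hQ₀ : 0 < Q₀) (hQ : Q₀ ≤ Q) (hh : h = d / (μ * Q))
    {M N : ℤ} (hM : M = ⌈1 / h * Real.arsinh (μ / α * Q)⌉)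
    (hN : N = ⌈1 / h * Real.arsinh (μ / β * Q)⌉) (x : ℝ) :
    ‖F x - sincSum F h M N x‖ ≤ 2 / (Real.pi * d) *
      (2 * L / (Real.pi * μ * (1 - Real.exp (-(2 * Real.pi * μ * Q₀))) *
        Real.cos (Real.pi / 2 * Real.sin d) ^ (α + β) * Real.cos d) + R) *
      Real.exp (-(Real.pi * μ * Q)) := by
  have hpi := Real.pi_pos
  have hμ0 : 0 < μ := hμ ▸ lt_min hα hβ
  have hQ0 : 0 < Q := hQ₀.trans_le hQ
  have hh0 : 0 < h := by rw [hh]; positivity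
  have hcosd : 0 < Real.cos d := Real.cos_pos_of_mem_Ioo ⟨by linarith, hd'⟩
  have hC0 := cos_pi_div_two_mul_sin_pos hd hd'
  have hnn : ∀ {γ : ℝ}, 0 < γ → 0 ≤ ⌈1 / h * Real.arsinh (μ / γ * Q)⌉ := fun {γ} hγ =>
    Int.ceil_nonneg (mul_nonneg (by positivity) (Real.arsinh_nonneg_iff.2 (by positivity)))
  have hMs : μ / α * Q ≤ Real.sinh (M * h) := hM ▸ le_sinh_ceil_mul hh0
  have hNs : μ / β * Q ≤ Real.sinh (N * h) := hN ▸ le_sinh_ceil_mul hh0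
  obtain ⟨M', rfl⟩ := Int.eq_ofNat_of_zero_le (hM ▸ hnn hα)
  obtain ⟨N', rfl⟩ := Int.eq_ofNat_of_zero_le (hN ▸ hnn hβ)
  rw [Int.cast_natCast] at hMs hNs
  have htail : ∀ᶠ m : ℕ in Filter.atTop, ‖sincSum F h m m x - sincSum F h M' N' x‖ ≤
      2 * R / (Real.pi * d) * Real.exp (-(Real.pi * μ * Q)) := by
    filter_upwards [Filter.eventually_ge_atTop M', Filter.eventually_ge_atTop N'] with m h1 h2
    have := hF.norm_sincSum_sub_le hR hα hβ hd hμ0 hQ0 hh hMs hNs x (m - N') (m - M')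
    rwa [Nat.add_sub_cancel' h1, Nat.add_sub_cancel' h2] at this
  have key := DESinc.norm_sub_sincSum_le
    (K := L / Real.cos (Real.pi / 2 * Real.sin d) ^ (α + β))
    (c := Real.pi * min α β * Real.cos d) hh0 (by rw [← hμ]; positivity) hd hF.analytic
    (fun t s hs => hF.norm_le hL hα hβ hd hd' t hs) htail
  refine key.trans ?_
  rw [← hμ]
  have hdh : Real.pi * d / h = Real.pi * μ * Q := by
    rw [hh]
    field_simp
  rw [hdh]
  set E := Real.exp (-(Real.pi * μ * Q)) with hE
  have hE0 : 0 < E := Real.exp_pos _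
  set E₀ := Real.exp (-(2 * Real.pi * μ * Q₀)) with hE₀
  have hEsq : E * E ≤ E₀ := by
    rw [hE, ← Real.exp_add, hE₀]
    apply Real.exp_le_exp.2
    have : Real.pi * μ * Q₀ ≤ Real.pi * μ * Q := by gcongr
    linarith
  have hE₀1 : E₀ < 1 := 
    (Real.exp_lt_exp.2 (neg_neg_of_pos (by positivity))).trans_eq Real.exp_zero
  -- sinh(πμQ) = (1 - E²)/(2E), and E² ≤ E₀ because Q₀ ≤ Q.
  have hsinh : (1 - E₀) / (2 * E) ≤ Real.sinh (Real.pi * μ * Q) := by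
    have e1 : Real.exp (Real.pi * μ * Q) = E⁻¹ := by rw [hE, Real.exp_neg, inv_inv]
    rw [Real.sinh_eq, e1, ← hE, div_le_iff₀ (by positivity)]
    field_simp
    linarith
  set C := Real.cos (Real.pi / 2 * Real.sin d) ^ (α + β) with hC
  have hC1 : 0 < C := Real.rpow_pos_of_pos hC0 _
  have h1E : 0 < 1 - E₀ := by linarith
  calc _ ≤ 2 * (L / C) / (Real.pi * (Real.pi * μ * Real.cos d * (d * ((1 - E₀) / (2 * E))))) +
        2 * R / (Real.pi * d) * E := by gcongr
    _ = _ := by field_simp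

end DESinc

theorem theorem5 (L R α β d : ℝ) (hL : 0 < L) (hR : 0 < R) (hα : 0 < α) (hβ : 0 < β)
    (hd : 0 < d) (hd' : d < Real.pi / 2)
    (F : ℂ → ℂ) (hF : DESinc.InClass L R α β d F)
    (q : ℝ → ℝ) (hq : ∀ x : ℝ, 0 ≤ x → 0 ≤ q x)
    (hq_diff : DifferentiableOn ℝ q (Set.Ici 0))
    (hq_deriv : ∀ x : ℝ, 0 ≤ x → 0 ≤ derivWithin q (Set.Ici 0) x)
    (μ : ℝ) (hμ : μ = min α β) (hq_pos : 0 < q (d / μ))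
    (n : ℕ) (hn : 1 ≤ n)
    (h : ℝ) (hh : h = DESinc.meshSize q d μ n)
    (M N : ℤ) (hM : M = DESinc.truncNumber q d μ α h n)
    (hN : N = DESinc.truncNumber q d μ β h n) :
    BddAbove (Set.range fun x : ℝ => ‖F (x : ℂ) - DESinc.sincSum F h M N x‖) ∧
      (⨆ x : ℝ, ‖F (x : ℂ) - DESinc.sincSum F h M N x‖) ≤
        DESinc.errorConst q L R α β d * Real.exp (-(Real.pi * μ * q (d * n / μ))) := by
  have hμ0 : 0 < μ := hμ ▸ lt_min hα hβ
  have hmono : q (d / μ) ≤ q (d * n / μ) := by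
    refine DESinc.monotoneOn_of_derivWithin_Ici_nonneg hq_diff hq_deriv
      (Set.mem_Ici.2 (by positivity)) (Set.mem_Ici.2 (by positivity)) ?_
    have : (1 : ℝ) ≤ n := by exact_mod_cast hn
    gcongr
    exact le_mul_of_one_le_right hd.le this
  have key : ∀ x : ℝ, ‖F (x : ℂ) - DESinc.sincSum F h M N x‖ ≤
      DESinc.errorConst q L R α β d * Real.exp (-(Real.pi * μ * q (d * n / μ))) := by
    intro x
    rw [DESinc.errorConst, ← hμ]
    exact hF.norm_sub_sincSum_le hL hR hα hβ hd hd' hμ hq_pos hmono hh hM hN x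
  -- A real supremum defaults to 0 on an unbounded family, so boundedness is what gives the estimate
  -- its meaning.
  exact ⟨⟨_, Set.forall_mem_range.2 key⟩, ciSup_le key⟩
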